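/- Let $N\ge 1$ and $M\ge 0$ be integers, let $k_1<k_2<\dots<k_M$ be positive integers with $k_M<N$ (no condition if $M=0$), and put $\Lambda=\{0,\dots,N\}\setminus\{k_1,\dots,k_M\}$. Let $\mathcal P(\Lambda)$ be the space of polynomials $\sum_{k\in\Lambda}c_kz^k$ with complex coefficients, normed by $\|p\|_1=\frac1{2\pi}\int_0^{2\pi}|p(e^{i\theta})|\,d\theta$, and let $\mathrm{ball}(\mathcal P(\Lambda))=\{q\in\mathcal P(\Lambda):\|q\|_1\le 1\}$. Let $p(z)=\sum_{k=0}^N c_kz^k\in\mathcal P(\Lambda)$ with $\|p\|_1=1$, and put $p^*(z)=\sum_{k=0}^N\overline{c_k}\,z^{N-k}$, so that $p^*(z)=z^N\overline{p(1/\bar z)}$ for $z\ne0$. Let $a_1,\dots,a_n$ be the distinct common zeros of $p$ and $p^*$ in the open unit disc $\{|z|<1\}$, let $m_j$ be the minimum of the multiplicities of $a_j$ as a zero of $p$ and as a zero of $p^*$, and put $m=\sum_{j=1}^n m_j$. The polynomial $$G(z)=\prod_{j=1}^n(z-a_j)^{m_j}(1-\overline{a_j}z)^{m_j}$$ divides $p$;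 let $R=p/G$, let $C_k$ be the coefficient of $z^k$ in the polynomial $R$ for integers $k\ge0$, and let $C_k=0$ for integers $k<0$. Write $A(k)=\operatorname{Re}C_k$ and $B(k)=\operatorname{Im}C_k$ for $k\in\mathbb Z$, and for $1\le j\le M$, $0\le l\le m$ put $$A^{\pm}_{j,l}=A(k_j+l-m)\pm A(k_j-l-m),\qquad B^{\pm}_{j,l}=B(k_j+l-m)\pm B(k_j-l-m).$$ Let $\mathcal A^+=(A^+_{j,l})$ and $\mathcal B^+=(B^+_{j,l})$ be the $M\times(m+1)$ matrices with $1\le j\le M$, $0\le l\le m$, let $\mathcal A^-=(A^-_{j,l})$ and $\mathcal B^-=(B^-_{j,l})$ be the $M\times m$ matrices with $1\le j\le M$, $1\le l\le m$, and let $$\mathfrak M=\begin{pmatrix}\mathcal A^+&\mathcal B^-\\ \mathcal B^+&-\mathcal A^-\end{pmatrix},$$ a real matrix with $2M$ rows and $2m+1$ columns. Then $p$ is an extreme point of $\mathrm{ball}(\mathcal P(\Lambda))$ if and only if $\operatorname{rank}\mathfrak M=2m$. -/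

import Mathlib

open Polynomial

noncomputable section

namespace Lacunary

/-- The frequency set `{0, …, N} \ {k₁, …, k_M}`. -/
def freqSet (N : ℕ) {M : ℕ} (k : Fin M → ℕ) : Finset ℕ :=
  Finset.range (N + 1) \ Finset.univ.image k

/-- The space of polynomials `∑_{k ∈ Λ} c_k z^k` with complex coefficients. -/
def polySpace (Λ : Finset ℕ) : Submodule ℂ ℂ[X] where
  carrier := {p | ∀ k, k ∉ Λ → p.coeff k = 0}
  add_mem' := fun {p q} hp hq k hk => by simp [hp k hk, hq k hk]
  zero_mem' := fun k _ => by simp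
  smul_mem' := fun c p hp k hk => by simp [hp k hk]

/-- The norm `(1/2π) ∫_𝕋 |p(ζ)| |dζ|`. -/
def l1Norm (p : ℂ[X]) : ℝ := Real.circleAverage (fun z => ‖p.eval z‖) 0 1

/-- The closed unit ball of `polySpace Λ` with respect to `l1Norm`. -/
def ball (Λ : Finset ℕ) : Set ℂ[X] := {p | p ∈ polySpace Λ ∧ l1Norm p ≤ 1}

/-- `p*(z) = ∑_{k ≤ N} conj(c_k) z^(N-k)` where `p(z) = ∑_{k ≤ N} c_k z^k`. -/
def pstar (N : ℕ) (p : ℂ[X]) : ℂ[X] := (p.map (starRingEnd ℂ)).reflect N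

/-- The distinct common zeros of `p` and `p*` in the open unit disc (for `p ≠ 0`). -/
def commonZeros (N : ℕ) (p : ℂ[X]) : Finset ℂ :=
  (p.roots.toFinset ∩ (pstar N p).roots.toFinset).filter fun a => ‖a‖ < 1

/-- The common multiplicity `min {mult(a, p), mult(a, p*)}`. -/
def commonMult (N : ℕ) (p : ℂ[X]) (a : ℂ) : ℕ :=
  min (p.rootMultiplicity a) ((pstar N p).rootMultiplicity a)

/-- The total multiplicity `m` of the common zeros of `p` and `p*` in the disc. -/
def totalMult (N : ℕ) (p : ℂ[X]) : ℕ := ∑ a ∈ commonZeros N p, commonMult N p a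

/-- `G(z) = ∏_j (z - a_j)^{m_j} (1 - conj(a_j) z)^{m_j}`. -/
def factorG (N : ℕ) (p : ℂ[X]) : ℂ[X] :=
  ∏ a ∈ commonZeros N p,
    (X - C a) ^ commonMult N p a * (1 - C (starRingEnd ℂ a) * X) ^ commonMult N p a

/-- The quotient `R = p / G`; the division is exact for nonzero `p` of degree at most `N`. -/
def factorR (N : ℕ) (p : ℂ[X]) : ℂ[X] := p / factorG N p

/-- The coefficient `C_k` of `R`, for any integer `k` (zero for negative `k`). -/
def intCoeff (R : ℂ[X]) (k : ℤ) : ℂ := if 0 ≤ k then R.coeff k.toNat else 0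

/-- `A(k_j + l - m) + A(k_j - l - m)`, where `A(k) = Re C_k` and `0 ≤ l ≤ m`. -/
def matAPlus (R : ℂ[X]) (m : ℕ) {M : ℕ} (k : Fin M → ℕ) : Matrix (Fin M) (Fin (m + 1)) ℝ :=
  Matrix.of fun j l =>
    (intCoeff R ((k j : ℤ) + (l : ℕ) - m)).re + (intCoeff R ((k j : ℤ) - (l : ℕ) - m)).re

/-- `B(k_j + l - m) + B(k_j - l - m)`, where `B(k) = Im C_k` and `0 ≤ l ≤ m`. -/
def matBPlus (R : ℂ[X]) (m : ℕ) {M : ℕ} (k : Fin M → ℕ) : Matrix (Fin M) (Fin (m + 1)) ℝ :=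
  Matrix.of fun j l =>
    (intCoeff R ((k j : ℤ) + (l : ℕ) - m)).im + (intCoeff R ((k j : ℤ) - (l : ℕ) - m)).im

/-- `A(k_j + l - m) - A(k_j - l - m)` for `1 ≤ l ≤ m`; column `i : Fin m` stands for
`l = i + 1`. -/
def matAMinus (R : ℂ[X]) (m : ℕ) {M : ℕ} (k : Fin M → ℕ) : Matrix (Fin M) (Fin m) ℝ :=
  Matrix.of fun j i =>
    (intCoeff R ((k j : ℤ) + ((i : ℕ) + 1) - m)).re
      - (intCoeff R ((k j : ℤ) - ((i : ℕ) + 1) - m)).re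

/-- `B(k_j + l - m) - B(k_j - l - m)` for `1 ≤ l ≤ m`; column `i : Fin m` stands for
`l = i + 1`. -/
def matBMinus (R : ℂ[X]) (m : ℕ) {M : ℕ} (k : Fin M → ℕ) : Matrix (Fin M) (Fin m) ℝ :=
  Matrix.of fun j i =>
    (intCoeff R ((k j : ℤ) + ((i : ℕ) + 1) - m)).im
      - (intCoeff R ((k j : ℤ) - ((i : ℕ) + 1) - m)).im

/-- The real block matrix with `2M` rows and `2m + 1` columns attached to `p`. -/
def blockMatrix (N : ℕ) {M : ℕ} (k : Fin M → ℕ) (p : ℂ[X]) :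
    Matrix (Fin M ⊕ Fin M) (Fin (totalMult N p + 1) ⊕ Fin (totalMult N p)) ℝ :=
  Matrix.fromBlocks
    (matAPlus (factorR N p) (totalMult N p) k) (matBMinus (factorR N p) (totalMult N p) k)
    (matBPlus (factorR N p) (totalMult N p) k) (-matAMinus (factorR N p) (totalMult N p) k)

end Lacunary

end

/-!
A unit vector `p` is extreme if and only if every `f ∈ 𝒫(Λ)` with `‖f‖₁ + ‖p - f‖₁ = ‖p‖₁` is a real
multiple of `p`. For the norm `‖·‖₁` this equality holds exactly when `f / p` takes values in
`[0, 1]` on the unit circle, so `p` is extreme if and only if the only `q ∈ 𝒫(Λ)` for which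
`q / p` is real and bounded on the circle are the real multiples of `p`.

On the circle `q / p` is real if and only if `q p* = p q*`. As `p = G R` and `p* = G R*`, where `R`
and `R*` have no common zero off the circle and boundedness takes care of the zeros on it, these
`q` are the products `S R` with `S = S*` of degree at most `2m`. They form a real vector space of
dimension `2m + 1`, in the natural coordinates of which `𝔐` lists the real and imaginary parts of
the coefficients of `S R` at the frequencies `k_j`. Hence `ker 𝔐` is the space of all `S` with
`S R ∈ 𝒫(Λ)`. It contains `G`, so `p` is extreme if and only if `ker 𝔐` is a line.
-/

namespace Lacunary

section ExtremePoints

theorem mem_extremePoints_unitBall_iff {E : Type*} [AddCommGroup E] [Module ℝ E]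
    (V : Submodule ℝ E) (ν : Seminorm ℝ E) {p : E} (hp : p ∈ V) (hν : ν p = 1) :
    p ∈ Set.extremePoints ℝ {x | x ∈ V ∧ ν x ≤ 1} ↔
      ∀ f ∈ V, ν f + ν (p - f) = 1 → f ∈ Submodule.span ℝ {p} := by
  simp only [mem_extremePoints_iff_left, Submodule.mem_span_singleton]
  constructor
  · rintro ⟨-, hext⟩ f hf hadd
    -- `p` is the midpoint of `p ± d`, and both ends lie in the ball because `p + d` and `p - d`
    -- are the sums of `(1 - ν f) • p`, `f` and of `p - f`, `ν f • p`.
    set d := f - ν f • p with hd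
    have hdV : d ∈ V := V.sub_mem hf (V.smul_mem _ hp)
    have hplus : ν (p + d) ≤ 1 := by
      calc ν (p + d) = ν ((1 - ν f) • p + f) := by rw [hd]; congr 1; module
        _ ≤ |1 - ν f| * ν p + ν f := by grw [map_add_le_add, map_smul_eq_mul, Real.norm_eq_abs]
        _ = 1 := by rw [abs_of_nonneg (by linarith [apply_nonneg ν (p - f)]), hν]; ring
    have hminus : ν (p - d) ≤ 1 := by
      calc ν (p - d) = ν ((p - f) + ν f • p) := by rw [hd]; congr 1; module
        _ ≤ ν (p - f) + |ν f| * ν p := by grw [map_add_le_add, map_smul_eq_mul, Real.norm_eq_abs]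
        _ = 1 := by rw [abs_of_nonneg (apply_nonneg ν f), hν]; linarith
    have hmid : p ∈ openSegment ℝ (p + d) (p - d) :=
      ⟨1 / 2, 1 / 2, by norm_num, by norm_num, by norm_num, by module⟩
    have hfix : p + d = p :=
      hext _ ⟨V.add_mem hp hdV, hplus⟩ _ ⟨V.sub_mem hp hdV, hminus⟩ hmid
    exact ⟨ν f, (sub_eq_zero.1 (add_eq_left.1 hfix)).symm⟩
  · refine fun H => ⟨⟨hp, hν.le⟩, ?_⟩
    rintro x ⟨hxV, hx⟩ y ⟨-, hy⟩ ⟨a, b, ha, hb, hab, hxy⟩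
    have hby : p - a • x = b • y := by rw [← hxy, add_sub_cancel_left]
    have hνx : ν (a • x) = a * ν x := by rw [map_smul_eq_mul, Real.norm_of_nonneg ha.le]
    have hνy : ν (b • y) = b * ν y := by rw [map_smul_eq_mul, Real.norm_of_nonneg hb.le]
    have htri : 1 ≤ ν (a • x) + ν (p - a • x) := by
      simpa [hν] using map_add_le_add ν (a • x) (p - a • x)
    have hxa : ν (a • x) ≤ a := by rw [hνx]; exact mul_le_of_le_one_right ha.le hx
    have hyb : ν (p - a • x) ≤ b := by rw [hby, hνy]; exact mul_le_of_le_one_right hb.le hy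
    obtain ⟨c, hc⟩ := H (a • x) (V.smul_mem a hxV) (by linarith)
    have hca : |c| ≤ a := by simpa [← hc, map_smul_eq_mul, hν] using hxa
    have hcb : |1 - c| ≤ b := by
      rwa [← hc, show p - c • p = (1 - c) • p by module, map_smul_eq_mul, hν, mul_one] at hyb
    have hac : a = c := by linarith [le_abs_self c, le_abs_self (1 - c)]
    exact (smul_right_injective E ha.ne' (hac ▸ hc)).symm

end ExtremePoints

section Rank

lemma rank_eq_iff_forall_mulVec_eq_zero {K ι κ : Type*} [Field K] [Fintype κ] {A : Matrix ι κ K}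
    {d : ℕ} (hd : Fintype.card κ = d + 1) {w : κ → K} (hw0 : w ≠ 0) (hw : A.mulVec w = 0) :
    A.rank = d ↔ ∀ v, A.mulVec v = 0 → v ∈ Submodule.span K {w} := by
  have hker : Module.finrank K (LinearMap.ker A.mulVecLin) = 1 ↔
      ∀ v, A.mulVec v = 0 → v ∈ Submodule.span K {w} := by
    rw [finrank_eq_one_iff_of_nonzero' (⟨w, hw⟩ : LinearMap.ker A.mulVecLin)
      (Subtype.coe_ne_coe.1 hw0)]
    simp only [Subtype.forall, LinearMap.mem_ker, Matrix.mulVecLin_apply, Subtype.ext_iff,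
      Submodule.coe_smul, Submodule.mem_span_singleton]
  have hrank : A.rank + Module.finrank K (LinearMap.ker A.mulVecLin) = d + 1 := by
    rw [Matrix.rank, LinearMap.finrank_range_add_finrank_ker, Module.finrank_fintype_fun_eq_card,
      hd]
  rw [← hker]
  omega

end Rank

section CircleAverage

theorem eqOn_sphere_of_circleAverage_eq {f g : ℂ → ℝ} {c : ℂ} {r : ℝ}
    (hf : ContinuousOn f (Metric.sphere c |r|)) (hg : ContinuousOn g (Metric.sphere c |r|))
    (hle : ∀ z ∈ Metric.sphere c |r|, f z ≤ g z)
    (h : Real.circleAverage f c r = Real.circleAverage g c r) :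
    Set.EqOn f g (Metric.sphere c |r|) := by
  intro z hz
  by_contra hne
  obtain ⟨θ, hθ, rfl⟩ := (image_circleMap_Ioc c r).symm ▸ hz
  have hmaps : Set.MapsTo (circleMap c r) (Set.Icc 0 (2 * Real.pi)) (Metric.sphere c |r|) :=
    fun x _ => circleMap_mem_sphere' c r x
  have hlt := intervalIntegral.integral_lt_integral_of_continuousOn_of_le_of_exists_lt
    Real.two_pi_pos (hf.comp (continuous_circleMap c r).continuousOn hmaps)
    (hg.comp (continuous_circleMap c r).continuousOn hmaps)
    (fun x _ => hle _ (circleMap_mem_sphere' c r x))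
    ⟨θ, Set.Ioc_subset_Icc_self hθ, lt_of_le_of_ne (hle _ hz) hne⟩
  refine hlt.ne (mul_left_cancel₀ (a := (2 * Real.pi)⁻¹) (by positivity) ?_)
  exact h

lemma circleIntegrable_norm_eval (f : ℂ[X]) (c : ℂ) (r : ℝ) :
    CircleIntegrable (fun z => ‖f.eval z‖) c r :=
  (by fun_prop : Continuous fun z => ‖f.eval z‖).continuousOn.circleIntegrable'

lemma circleAverage_norm_eval_add_norm_eval (f g : ℂ[X]) :
    Real.circleAverage (fun z => ‖f.eval z‖ + ‖g.eval z‖) 0 1 = l1Norm f + l1Norm g :=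
  Real.circleAverage_fun_add (circleIntegrable_norm_eval f 0 1) (circleIntegrable_norm_eval g 0 1)

lemma l1Norm_add_le (f g : ℂ[X]) : l1Norm (f + g) ≤ l1Norm f + l1Norm g := by
  rw [← circleAverage_norm_eval_add_norm_eval]
  refine Real.circleAverage_mono (circleIntegrable_norm_eval _ 0 1)
    ((circleIntegrable_norm_eval f 0 1).add (circleIntegrable_norm_eval g 0 1)) fun z _ => ?_
  rw [eval_add]
  exact norm_add_le _ _

lemma l1Norm_smul (c : ℝ) (f : ℂ[X]) : l1Norm (c • f) = ‖c‖ * l1Norm f := by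
  simp only [l1Norm, eval_smul, norm_smul]
  exact Real.circleAverage_fun_smul (a := ‖c‖)

/-- `l1Norm` as a seminorm over `ℝ`, the form in which the description of extreme points of a unit
ball applies to it. -/
noncomputable def l1Seminorm : Seminorm ℝ ℂ[X] := Seminorm.of l1Norm l1Norm_add_le l1Norm_smul

lemma ne_zero_of_l1Norm_eq_one {p : ℂ[X]} (h : l1Norm p = 1) : p ≠ 0 := by
  rintro rfl
  exact zero_ne_one ((map_zero l1Seminorm).symm.trans h)

lemma l1Norm_add_eq_iff {f g : ℂ[X]} :
    l1Norm (f + g) = l1Norm f + l1Norm g ↔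
      ∀ z : ℂ, ‖z‖ = 1 → ‖f.eval z + g.eval z‖ = ‖f.eval z‖ + ‖g.eval z‖ := by
  rw [← circleAverage_norm_eval_add_norm_eval]
  constructor
  · intro h z hz
    rw [← eval_add]
    refine eqOn_sphere_of_circleAverage_eq (c := 0) (r := 1) (f := fun z => ‖(f + g).eval z‖)
      (by fun_prop) (by fun_prop) (fun z _ => ?_) h (by simpa using hz)
    rw [eval_add]
    exact norm_add_le _ _
  · intro h
    refine Real.circleAverage_congr_sphere fun z hz => ?_
    rw [eval_add]
    exact h z (by simpa using hz)

end CircleAverage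

section BoundedRealRatio

/-- The quotient `q / p` is real and bounded on the unit circle. Stated without division, so that
`q` is required to vanish wherever `p` does. -/
def HasBoundedRealRatio (p q : ℂ[X]) : Prop :=
  ∃ K : ℝ, ∀ z : ℂ, ‖z‖ = 1 → ∃ t : ℝ, |t| ≤ K ∧ q.eval z = t * p.eval z

lemma HasBoundedRealRatio.mul_right {p q : ℂ[X]} (h : HasBoundedRealRatio p q) (r : ℂ[X]) :
    HasBoundedRealRatio (p * r) (q * r) := by
  obtain ⟨K, hK⟩ := h
  refine ⟨K, fun z hz => ?_⟩
  obtain ⟨t, ht, hq⟩ := hK z hz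
  exact ⟨t, ht, by rw [eval_mul, eval_mul, hq, mul_assoc]⟩

lemma hasBoundedRealRatio_add_of_l1Norm_add_eq {f g : ℂ[X]}
    (h : l1Norm (f + g) = l1Norm f + l1Norm g) : HasBoundedRealRatio (f + g) f := by
  refine ⟨1, fun z hz => ?_⟩
  obtain ⟨a, b, ha, hb, hab, hf, -⟩ :=
    (sameRay_iff_norm_add.2 (l1Norm_add_eq_iff.1 h z hz)).exists_eq_smul_add
  refine ⟨a, by rw [abs_of_nonneg ha]; linarith, ?_⟩
  rw [eval_add, ← Complex.real_smul, ← hf]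

lemma HasBoundedRealRatio.exists_l1Norm_add_eq {p q : ℂ[X]} (h : HasBoundedRealRatio p q) :
    ∃ ε : ℝ, ε ≠ 0 ∧
      l1Norm ((1 / 2 : ℝ) • p + ε • q) + l1Norm (p - ((1 / 2 : ℝ) • p + ε • q)) = l1Norm p := by
  obtain ⟨K, hK⟩ := h
  -- `ε K < 1 / 2`, so the two parts are `p` times the nonnegative functions `1 / 2 ± ε q / p`.
  set ε : ℝ := (2 * (|K| + 1))⁻¹ with hε
  have hε0 : 0 < ε := by positivity
  set f := (1 / 2 : ℝ) • p + ε • q with hf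
  refine ⟨ε, hε0.ne', ?_⟩
  have hsum : l1Norm (f + (p - f)) = l1Norm f + l1Norm (p - f) := by
    refine l1Norm_add_eq_iff.2 fun z hz => ?_
    obtain ⟨t, ht, hq⟩ := hK z hz
    have hbound : |ε * t| ≤ 1 / 2 := by
      rw [abs_mul, abs_of_pos hε0, hε, inv_mul_le_iff₀ (by positivity)]
      linarith [le_abs_self K]
    have hfz : f.eval z = (1 / 2 + ε * t) • p.eval z := by
      rw [hf, eval_add, eval_smul, eval_smul, hq, ← Complex.real_smul, smul_smul, ← add_smul]
    have hgz : (p - f).eval z = (1 / 2 - ε * t) • p.eval z := by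
      rw [eval_sub, hfz]
      module
    rw [hfz, hgz]
    exact (((SameRay.refl (p.eval z)).nonneg_smul_left
      (by linarith [neg_le_of_abs_le hbound])).nonneg_smul_right
      (by linarith [le_of_abs_le hbound])).norm_add
  rw [← hsum, add_sub_cancel]

theorem mem_extremePoints_ball_iff {Λ : Finset ℕ} {p : ℂ[X]} (hp : p ∈ polySpace Λ)
    (hnorm : l1Norm p = 1) :
    p ∈ Set.extremePoints ℝ (ball Λ) ↔
      ∀ q ∈ polySpace Λ, HasBoundedRealRatio p q → q ∈ Submodule.span ℝ {p} := by
  let V := (polySpace Λ).restrictScalars ℝ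
  refine (mem_extremePoints_unitBall_iff V l1Seminorm hp hnorm).trans
    ⟨fun H q hq hpq => ?_, fun H f hf hadd => H f hf ?_⟩
  · obtain ⟨ε, hε, hadd⟩ := hpq.exists_l1Norm_add_eq
    have hspan := H _ (V.add_mem (V.smul_mem _ hp) (V.smul_mem ε hq)) (hadd.trans hnorm)
    rwa [Submodule.add_mem_iff_right _
        (Submodule.smul_mem _ _ (Submodule.mem_span_singleton_self p)),
      Submodule.smul_mem_iff _ hε] at hspan
  · have hsum : l1Norm (f + (p - f)) = l1Norm f + l1Norm (p - f) := by
      rw [add_sub_cancel, hnorm]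
      exact hadd.symm
    simpa only [add_sub_cancel] using hasBoundedRealRatio_add_of_l1Norm_add_eq hsum

end BoundedRealRatio

section Reflection

lemma pstar_pstar (n : ℕ) (f : ℂ[X]) : pstar n (pstar n f) = f := by
  simp [pstar, reflect_map, Polynomial.map_map]

lemma pstar_ne_zero (n : ℕ) {f : ℂ[X]} (hf : f ≠ 0) : pstar n f ≠ 0 := by
  simpa [pstar] using hf

lemma natDegree_pstar_le {n : ℕ} {f : ℂ[X]} (hf : f.natDegree ≤ n) :
    (pstar n f).natDegree ≤ n :=
  natDegree_reflect_le.trans (max_le le_rfl (natDegree_map_le.trans hf))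

lemma coeff_pstar {n i : ℕ} (f : ℂ[X]) (hi : i ≤ n) :
    (pstar n f).coeff i = starRingEnd ℂ (f.coeff (n - i)) := by
  simp [pstar, coeff_reflect, revAt_le hi]

lemma eval_zero_pstar (n : ℕ) (f : ℂ[X]) :
    (pstar n f).eval 0 = starRingEnd ℂ (f.coeff n) := by
  rw [← coeff_zero_eq_eval_zero, coeff_pstar f n.zero_le, Nat.sub_zero]

lemma pstar_add (n : ℕ) (f g : ℂ[X]) : pstar n (f + g) = pstar n f + pstar n g := by
  simp [pstar, reflect_add]

lemma pstar_real_smul (n : ℕ) (c : ℝ) (f : ℂ[X]) : pstar n (c • f) = c • pstar n f := by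
  ext i
  simp [pstar, coeff_reflect]

lemma pstar_mul {a b : ℕ} {f g : ℂ[X]} (hf : f.natDegree ≤ a) (hg : g.natDegree ≤ b) :
    pstar (a + b) (f * g) = pstar a f * pstar b g := by
  rw [pstar, Polynomial.map_mul, reflect_mul _ _ (natDegree_map_le.trans hf)
    (natDegree_map_le.trans hg), pstar, pstar]

lemma pstar_prod {ι : Type*} (s : Finset ι) {d : ι → ℕ} {f : ι → ℂ[X]}
    (hf : ∀ i ∈ s, (f i).natDegree ≤ d i) :
    pstar (∑ i ∈ s, d i) (∏ i ∈ s, f i) = ∏ i ∈ s, pstar (d i) (f i) := by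
  induction s using Finset.cons_induction with
  | empty => simp [pstar]
  | cons i s hi ih =>
    rw [Finset.forall_mem_cons] at hf
    rw [Finset.sum_cons, Finset.prod_cons, Finset.prod_cons, ← ih hf.2, pstar_mul hf.1]
    exact (natDegree_prod_le _ _).trans (Finset.sum_le_sum hf.2)

lemma pstar_X_sub_C_pow (a : ℂ) (j : ℕ) :
    pstar j ((X - C a) ^ j) = (1 - C (starRingEnd ℂ a) * X) ^ j := by
  simpa [pstar, reflect_sub, reflect_C] using
    pstar_prod (Finset.range j) (d := fun _ => 1) fun _ _ => (natDegree_X_sub_C a).le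

lemma pstar_C_mul_X_pow {n i : ℕ} (c : ℂ) (hi : i ≤ n) :
    pstar n (C c * X ^ i) = C (starRingEnd ℂ c) * X ^ (n - i) := by
  simp [pstar, revAt_le hi]

lemma pstar_dvd_pstar {n : ℕ} {f g : ℂ[X]} (hg : g.natDegree ≤ n) (h : f ∣ g) :
    pstar f.natDegree f ∣ pstar n g := by
  obtain ⟨u, rfl⟩ := h
  rcases eq_or_ne (f * u) 0 with h0 | h0
  · simp [h0, pstar]
  rw [natDegree_mul (left_ne_zero_of_mul h0) (right_ne_zero_of_mul h0)] at hg
  obtain ⟨d, rfl⟩ := Nat.exists_eq_add_of_le ((Nat.le_add_right _ _).trans hg)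
  rw [pstar_mul le_rfl (Nat.add_le_add_iff_left.1 hg)]
  exact dvd_mul_right _ _

lemma eval_pstar {n : ℕ} {f : ℂ[X]} (hf : f.natDegree ≤ n) {z : ℂ} (hz : z ≠ 0) :
    (pstar n f).eval z = z ^ n * starRingEnd ℂ (f.eval (starRingEnd ℂ z)⁻¹) := by
  let _ : Invertible z⁻¹ := invertibleOfNonzero (inv_ne_zero hz)
  have hconj : starRingEnd ℂ (f.eval (starRingEnd ℂ z)⁻¹) = (f.map (starRingEnd ℂ)).eval z⁻¹ := by
    rw [eval_map, ← eval₂_at_apply, map_inv₀, Complex.conj_conj]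
  have hreflect := eval₂_reflect_mul_pow (RingHom.id ℂ) z⁻¹ n (f.map (starRingEnd ℂ))
    (natDegree_map_le.trans hf)
  simp only [invOf_eq_inv, inv_inv] at hreflect
  rw [hconj, eval, eval, ← hreflect, pstar, inv_pow, mul_left_comm,
    mul_inv_cancel₀ (pow_ne_zero n hz), mul_one]

lemma eval_pstar_of_norm_eq_one {n : ℕ} {f : ℂ[X]} (hf : f.natDegree ≤ n) {z : ℂ}
    (hz : ‖z‖ = 1) : (pstar n f).eval z = z ^ n * starRingEnd ℂ (f.eval z) := by
  rw [eval_pstar hf (norm_ne_zero_iff.1 (hz ▸ one_ne_zero)),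
    ← Complex.inv_eq_conj hz, inv_inv]

lemma eval_pstar_inv_conj_eq_zero {n : ℕ} {f : ℂ[X]} (hf : f.natDegree ≤ n) {z : ℂ} (hz : z ≠ 0)
    (h : f.eval z = 0) : (pstar n f).eval (starRingEnd ℂ z)⁻¹ = 0 := by
  rw [eval_pstar hf (by simpa using hz)]
  simp [h]

lemma isCoprime_pstar_of_norm_roots_lt_one {f : ℂ[X]} (h : ∀ z : ℂ, f.eval z = 0 → ‖z‖ < 1) :
    IsCoprime f (pstar f.natDegree f) := by
  have hf0 : f ≠ 0 := by
    rintro rfl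
    simpa using h 1 eval_zero
  rw [isCoprime_iff_aeval_ne_zero_of_isAlgClosed ℂ ℂ]
  simp only [coe_aeval_eq_eval, or_iff_not_imp_left, not_not]
  intro a ha ha'
  rcases eq_or_ne a 0 with rfl | ha0
  · rw [eval_zero_pstar, map_eq_zero, coeff_natDegree, leadingCoeff_eq_zero] at ha'
    exact hf0 ha'
  · have hinv := eval_pstar_inv_conj_eq_zero (natDegree_pstar_le le_rfl) ha0 ha'
    rw [pstar_pstar] at hinv
    have hlt := h _ hinv
    rw [norm_inv, RCLike.norm_conj] at hlt
    exact (one_lt_inv₀ (norm_pos_iff.2 ha0)).2 (h a ha) |>.not_gt hlt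

end Reflection

section SelfReciprocal

/-- The real vector space of the polynomials `S` of degree at most `d` with `S* = S`, where `S*` is
formed with respect to the degree bound `d` and not to the degree of `S`. -/
noncomputable def selfReciprocal (d : ℕ) : Submodule ℝ ℂ[X] where
  carrier := {S | S.natDegree ≤ d ∧ pstar d S = S}
  add_mem' := fun hS hT =>
    ⟨natDegree_add_le_of_degree_le hS.1 hT.1, by rw [pstar_add, hS.2, hT.2]⟩
  zero_mem' := ⟨by simp, by simp [pstar]⟩
  smul_mem' := fun c S hS =>
    ⟨(natDegree_smul_le c S).trans hS.1, by rw [pstar_real_smul, hS.2]⟩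

lemma add_pstar_mem_selfReciprocal {d : ℕ} {f : ℂ[X]} (hf : f.natDegree ≤ d) :
    f + pstar d f ∈ selfReciprocal d :=
  ⟨natDegree_add_le_of_degree_le hf (natDegree_pstar_le hf), by
    rw [pstar_add, pstar_pstar, add_comm]⟩

lemma mul_pstar_mem_selfReciprocal {d : ℕ} {f : ℂ[X]} (hf : f.natDegree ≤ d) :
    f * pstar d f ∈ selfReciprocal (2 * d) := by
  rw [two_mul]
  exact ⟨natDegree_mul_le_of_le hf (natDegree_pstar_le hf), by
    rw [pstar_mul hf (natDegree_pstar_le hf), pstar_pstar, mul_comm]⟩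

lemma coeff_eq_conj_coeff_of_mem_selfReciprocal {d i : ℕ} {S : ℂ[X]} (hS : S ∈ selfReciprocal d)
    (hi : i ≤ d) : S.coeff i = starRingEnd ℂ (S.coeff (d - i)) := by
  rw [← coeff_pstar S hi, hS.2]

lemma eval_eq_of_mem_selfReciprocal {d : ℕ} {S : ℂ[X]} (hS : S ∈ selfReciprocal d) {z : ℂ}
    (hz : ‖z‖ = 1) : S.eval z = z ^ d * starRingEnd ℂ (S.eval z) := by
  rw [← eval_pstar_of_norm_eq_one hS.1 hz, hS.2]

lemma hasBoundedRealRatio_of_mem_selfReciprocal {d : ℕ} {S T : ℂ[X]} (hS : S ∈ selfReciprocal d)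
    (hT : T ∈ selfReciprocal d) (hT0 : ∀ z : ℂ, ‖z‖ = 1 → T.eval z ≠ 0) :
    HasBoundedRealRatio T S := by
  have hcont : ContinuousOn (fun z => S.eval z / T.eval z) (Metric.sphere 0 1) :=
    S.continuousOn.div T.continuousOn fun z hz => hT0 z (by simpa using hz)
  obtain ⟨K, hK⟩ := (isCompact_sphere (0 : ℂ) 1).exists_bound_of_continuousOn hcont
  refine ⟨K, fun z hz => ⟨(S.eval z / T.eval z).re, ?_, ?_⟩⟩
  · exact (Complex.abs_re_le_norm _).trans (hK z (by simpa using hz))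
  · have hz0 : z ^ d ≠ 0 := pow_ne_zero d (norm_ne_zero_iff.1 (hz ▸ one_ne_zero))
    have hreal : starRingEnd ℂ (S.eval z / T.eval z) = S.eval z / T.eval z := by
      rw [map_div₀, ← mul_div_mul_left _ _ hz0, ← eval_eq_of_mem_selfReciprocal hS hz,
        ← eval_eq_of_mem_selfReciprocal hT hz]
    rw [Complex.conj_eq_iff_re.1 hreal, div_mul_cancel₀ _ (hT0 z hz)]

end SelfReciprocal

section Factorization

/-- The greatest common divisor of `p` and `p*` with respect to their zeros in the open unit disc,
`D(z) = ∏_j (z - a_j)^{m_j}`; then `G = D D*`, where `D*` is formed with respect to `m`. -/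
noncomputable def discFactor (N : ℕ) (p : ℂ[X]) : ℂ[X] :=
  ∏ a ∈ commonZeros N p, (X - C a) ^ commonMult N p a

variable {N : ℕ} {p : ℂ[X]}

lemma norm_lt_one_of_mem_commonZeros {a : ℂ} (ha : a ∈ commonZeros N p) : ‖a‖ < 1 :=
  (Finset.mem_filter.1 ha).2

lemma mem_commonZeros (hp0 : p ≠ 0) {a : ℂ} :
    a ∈ commonZeros N p ↔ p.eval a = 0 ∧ (pstar N p).eval a = 0 ∧ ‖a‖ < 1 := by
  simp [commonZeros, hp0, pstar_ne_zero N hp0, and_assoc]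

lemma natDegree_discFactor : (discFactor N p).natDegree = totalMult N p := by
  rw [discFactor, natDegree_prod_of_monic _ _ fun a _ => (monic_X_sub_C a).pow _]
  simp [totalMult]

lemma pstar_discFactor : pstar (totalMult N p) (discFactor N p) =
    ∏ a ∈ commonZeros N p, (1 - C (starRingEnd ℂ a) * X) ^ commonMult N p a := by
  have hdeg (a : ℂ) : ((X - C a) ^ commonMult N p a).natDegree ≤ commonMult N p a := by simp
  rw [totalMult, discFactor, pstar_prod _ fun a _ => hdeg a]
  exact Finset.prod_congr rfl fun a _ => pstar_X_sub_C_pow a _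

lemma factorG_eq : factorG N p = discFactor N p * pstar (totalMult N p) (discFactor N p) := by
  rw [pstar_discFactor, discFactor, ← Finset.prod_mul_distrib, factorG]

lemma factorG_mem_selfReciprocal : factorG N p ∈ selfReciprocal (2 * totalMult N p) := by
  rw [factorG_eq]
  exact mul_pstar_mem_selfReciprocal natDegree_discFactor.le

lemma discFactor_ne_zero : discFactor N p ≠ 0 :=
  (monic_prod_of_monic _ _ fun a _ => (monic_X_sub_C a).pow _).ne_zero

lemma factorG_ne_zero : factorG N p ≠ 0 := by
  rw [factorG_eq]
  exact mul_ne_zero discFactor_ne_zero (pstar_ne_zero _ discFactor_ne_zero)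

lemma norm_lt_one_of_eval_discFactor_eq_zero {a : ℂ} (h : (discFactor N p).eval a = 0) :
    ‖a‖ < 1 := by
  rw [discFactor, eval_prod, Finset.prod_eq_zero_iff] at h
  obtain ⟨b, hb, hba⟩ := h
  rw [eval_pow, eval_sub, eval_X, eval_C] at hba
  rw [sub_eq_zero.1 (eq_zero_of_pow_eq_zero hba)]
  exact norm_lt_one_of_mem_commonZeros hb

lemma eval_factorG_ne_zero {z : ℂ} (hz : ‖z‖ = 1) : (factorG N p).eval z ≠ 0 := by
  have hD : (discFactor N p).eval z ≠ 0 := fun h =>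
    (norm_lt_one_of_eval_discFactor_eq_zero h).ne hz
  rw [factorG_eq, eval_mul, eval_pstar_of_norm_eq_one natDegree_discFactor.le hz]
  have hz0 : z ≠ 0 := norm_ne_zero_iff.1 (hz ▸ one_ne_zero)
  simp [hD, hz0]

lemma discFactor_dvd_of_le_rootMultiplicity {f : ℂ[X]}
    (h : ∀ a, commonMult N p a ≤ f.rootMultiplicity a) : discFactor N p ∣ f :=
  Finset.prod_dvd_of_coprime
    (fun _ _ _ _ hab => (isCoprime_X_sub_C_of_isUnit_sub (sub_ne_zero.2 hab).isUnit).pow)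
    fun a _ => (pow_dvd_pow _ (h a)).trans (pow_rootMultiplicity_dvd f a)

lemma discFactor_dvd : discFactor N p ∣ p :=
  discFactor_dvd_of_le_rootMultiplicity fun _ => min_le_left _ _

lemma discFactor_dvd_pstar : discFactor N p ∣ pstar N p :=
  discFactor_dvd_of_le_rootMultiplicity fun _ => min_le_right _ _

lemma factorG_dvd (hp : p.natDegree ≤ N) : factorG N p ∣ p := by
  have hcop := isCoprime_pstar_of_norm_roots_lt_one fun _ =>
    norm_lt_one_of_eval_discFactor_eq_zero (N := N) (p := p)
  have hdvd := pstar_dvd_pstar (natDegree_pstar_le hp) (discFactor_dvd_pstar (N := N) (p := p))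
  rw [pstar_pstar, natDegree_discFactor] at hdvd
  rw [natDegree_discFactor] at hcop
  rw [factorG_eq]
  exact hcop.mul_dvd discFactor_dvd hdvd

lemma factorG_mul_factorR (hp : p.natDegree ≤ N) : factorG N p * factorR N p = p :=
  EuclideanDomain.mul_div_cancel' factorG_ne_zero (factorG_dvd hp)

lemma factorR_ne_zero (hp0 : p ≠ 0) (hp : p.natDegree ≤ N) : factorR N p ≠ 0 :=
  right_ne_zero_of_mul (factorG_mul_factorR hp ▸ hp0)

lemma natDegree_factorR_add_le (hp0 : p ≠ 0) (hp : p.natDegree ≤ N) :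
    (factorR N p).natDegree + 2 * totalMult N p ≤ N := by
  set D := discFactor N p
  set m := totalMult N p
  have hD0 : D ≠ 0 := discFactor_ne_zero
  have hDm : D.natDegree = m := natDegree_discFactor
  obtain ⟨v, hv⟩ : D ∣ pstar N p := discFactor_dvd_pstar
  have hv0 : v ≠ 0 := right_ne_zero_of_mul (hv ▸ pstar_ne_zero N hp0)
  have hmv : m + v.natDegree ≤ N := by
    rw [← hDm, ← natDegree_mul hD0 hv0, ← hv]
    exact natDegree_pstar_le hp
  obtain ⟨d, hN⟩ := Nat.exists_eq_add_of_le ((Nat.le_add_right _ _).trans hmv)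
  have hvd : v.natDegree ≤ d := Nat.add_le_add_iff_left.1 (hN ▸ hmv)
  have hDR : D * factorR N p = pstar d v := by
    refine mul_left_cancel₀ (pstar_ne_zero m hD0) ?_
    calc pstar m D * (D * factorR N p) = factorG N p * factorR N p := by rw [factorG_eq]; ring
      _ = pstar N (D * v) := by rw [factorG_mul_factorR hp, ← hv, pstar_pstar]
      _ = pstar m D * pstar d v := by rw [hN, pstar_mul hDm.le hvd]
  have hdeg : (D * factorR N p).natDegree ≤ d := hDR ▸ natDegree_pstar_le hvd
  rw [natDegree_mul hD0 (factorR_ne_zero hp0 hp), hDm] at hdeg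
  omega

/-- The reflection `R*` of `R = p / G`, formed with respect to the degree bound `N - 2m`, so that
`p* = G R*`. -/
noncomputable def factorRStar (N : ℕ) (p : ℂ[X]) : ℂ[X] :=
  pstar (N - 2 * totalMult N p) (factorR N p)

lemma factorG_mul_factorRStar (hp0 : p ≠ 0) (hp : p.natDegree ≤ N) :
    factorG N p * factorRStar N p = pstar N p := by
  have hdeg := natDegree_factorR_add_le hp0 hp
  have hG := factorG_mem_selfReciprocal (N := N) (p := p)
  calc factorG N p * factorRStar N p
      = pstar (2 * totalMult N p + (N - 2 * totalMult N p)) (factorG N p * factorR N p) := by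
        rw [pstar_mul hG.1 (by omega), hG.2, factorRStar]
    _ = pstar N p := by rw [factorG_mul_factorR hp, Nat.add_sub_cancel' (by omega)]

lemma eval_factorRStar_ne_zero_of_norm_lt_one (hp0 : p ≠ 0) (hp : p.natDegree ≤ N) {a : ℂ}
    (ha : ‖a‖ < 1) (hR : (factorR N p).eval a = 0) : (factorRStar N p).eval a ≠ 0 := by
  intro hR'
  have hGR := factorG_mul_factorR hp
  have hGR' := factorG_mul_factorRStar hp0 hp
  have hmem : a ∈ commonZeros N p :=
    (mem_commonZeros hp0).2 ⟨by rw [← hGR, eval_mul, hR, mul_zero],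
      by rw [← hGR', eval_mul, hR', mul_zero], ha⟩
  have hG : (X - C a) ^ commonMult N p a ∣ factorG N p := by
    rw [factorG_eq]
    exact (Finset.dvd_prod_of_mem _ hmem).mul_right _
  -- A common zero of `R` and `R*` would raise the common multiplicity of `a` by one.
  have hp_dvd : (X - C a) ^ (commonMult N p a + 1) ∣ p := by
    simpa only [hGR, ← pow_succ] using mul_dvd_mul hG (dvd_iff_isRoot.2 hR)
  have hpstar_dvd : (X - C a) ^ (commonMult N p a + 1) ∣ pstar N p := by
    simpa only [hGR', ← pow_succ] using mul_dvd_mul hG (dvd_iff_isRoot.2 hR')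
  have hle : commonMult N p a + 1 ≤ min (p.rootMultiplicity a) ((pstar N p).rootMultiplicity a) :=
    le_min ((le_rootMultiplicity_iff hp0).2 hp_dvd)
      ((le_rootMultiplicity_iff (pstar_ne_zero N hp0)).2 hpstar_dvd)
  exact Nat.not_succ_le_self _ hle

lemma eval_factorRStar_ne_zero (hp0 : p ≠ 0) (hp : p.natDegree ≤ N) {a : ℂ} (ha : ‖a‖ ≠ 1)
    (hR : (factorR N p).eval a = 0) : (factorRStar N p).eval a ≠ 0 := by
  rcases ha.lt_or_gt with hlt | hgt
  · exact eval_factorRStar_ne_zero_of_norm_lt_one hp0 hp hlt hR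
  intro hR'
  have hdeg : (factorR N p).natDegree ≤ N - 2 * totalMult N p := by
    have := natDegree_factorR_add_le hp0 hp
    omega
  have ha0 : a ≠ 0 := norm_pos_iff.1 (zero_lt_one.trans hgt)
  have hinv : ‖(starRingEnd ℂ a)⁻¹‖ < 1 := by
    rw [norm_inv, RCLike.norm_conj]
    exact inv_lt_one_of_one_lt₀ hgt
  have hRinv : (factorR N p).eval (starRingEnd ℂ a)⁻¹ = 0 := by
    simpa only [factorRStar, pstar_pstar] using
      eval_pstar_inv_conj_eq_zero (natDegree_pstar_le hdeg) ha0 hR'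
  exact eval_factorRStar_ne_zero_of_norm_lt_one hp0 hp hinv hRinv
    (eval_pstar_inv_conj_eq_zero hdeg ha0 hR)

end Factorization

section Multipliers

lemma X_sub_C_pow_dvd_of_norm_eval_le {𝕜 : Type*} [NormedField 𝕜] {U : Set 𝕜} (hU : Preperfect U)
    {K : ℝ} {a : 𝕜} (ha : a ∈ U) (n : ℕ) {f g : 𝕜[X]}
    (hfg : ∀ z ∈ U, ‖f.eval z‖ ≤ K * ‖g.eval z‖) (h : (X - C a) ^ n ∣ g) :
    (X - C a) ^ n ∣ f := by
  induction n generalizing f g with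
  | zero => exact pow_zero (X - C a) ▸ one_dvd f
  | succ n ih =>
    obtain ⟨u, rfl⟩ := h
    obtain ⟨f₁, rfl⟩ : X - C a ∣ f := dvd_iff_isRoot.2 (by simpa using hfg a ha)
    rw [pow_succ', mul_assoc] at hfg
    rw [pow_succ']
    refine mul_dvd_mul_left _ (ih (g := (X - C a) ^ n * u) (fun z hz => ?_) (dvd_mul_right _ _))
    have hoff : ∀ z ∈ U \ {a}, ‖f₁.eval z‖ ≤ K * ‖((X - C a) ^ n * u).eval z‖ := by
      rintro z ⟨hzU, hza⟩
      have hle := hfg z hzU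
      rw [eval_mul, eval_mul (p := X - C a), norm_mul, norm_mul, mul_left_comm] at hle
      exact le_of_mul_le_mul_left hle (by simpa [sub_eq_zero] using hza)
    rcases eq_or_ne z a with rfl | hza
    · have hclosed : IsClosed {w | ‖f₁.eval w‖ ≤ K * ‖((X - C z) ^ n * u).eval w‖} :=
        isClosed_le (by fun_prop) (by fun_prop)
      exact closure_minimal hoff hclosed
        (mem_closure_iff_clusterPt.2 (accPt_principal_iff_clusterPt.1 (hU z hz)))
    · exact hoff z ⟨hz, hza⟩

lemma preperfect_unitCircle : Preperfect (Metric.sphere (0 : ℂ) 1) :=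
  (isPreconnected_sphere (by simp [Complex.rank_real_complex]) 0 1).preperfect_of_nontrivial
    ⟨1, by simp, -1, by simp, by norm_num⟩

lemma HasBoundedRealRatio.mul_pstar_eq {n : ℕ} {p q : ℂ[X]} (h : HasBoundedRealRatio p q)
    (hp : p.natDegree ≤ n) (hq : q.natDegree ≤ n) : q * pstar n p = p * pstar n q := by
  obtain ⟨K, hK⟩ := h
  refine eq_of_infinite_eval_eq _ _
    ((Set.Infinite.of_accPt (preperfect_unitCircle 1 (by simp))).mono fun z hz => ?_)
  have hz1 : ‖z‖ = 1 := by simpa using hz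
  obtain ⟨t, -, ht⟩ := hK z hz1
  change (q * pstar n p).eval z = (p * pstar n q).eval z
  rw [eval_mul, eval_mul, eval_pstar_of_norm_eq_one hp hz1, eval_pstar_of_norm_eq_one hq hz1, ht,
    map_mul, Complex.conj_ofReal]
  ring

lemma HasBoundedRealRatio.X_sub_C_pow_dvd {p q : ℂ[X]} (h : HasBoundedRealRatio p q) {a : ℂ}
    (ha : ‖a‖ = 1) {n : ℕ} (hdvd : (X - C a) ^ n ∣ p) : (X - C a) ^ n ∣ q := by
  obtain ⟨K, hK⟩ := h
  refine X_sub_C_pow_dvd_of_norm_eval_le (K := K) preperfect_unitCircle (by simpa using ha) n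
    (fun z hz => ?_) hdvd
  obtain ⟨t, ht, hq⟩ := hK z (by simpa using hz)
  rw [hq, norm_mul, Complex.norm_real, Real.norm_eq_abs]
  gcongr

lemma HasBoundedRealRatio.dvd_of_mul_eq {p q R R' u : ℂ[X]} (h : HasBoundedRealRatio p q)
    (hR0 : R ≠ 0) (hRp : R ∣ p) (hmul : q * R' = R * u)
    (hR' : ∀ a : ℂ, ‖a‖ ≠ 1 → R.eval a = 0 → R'.eval a ≠ 0) : R ∣ q := by
  rcases eq_or_ne q 0 with rfl | hq0
  · exact dvd_zero R
  rw [IsAlgClosed.dvd_iff_roots_le_roots hR0 hq0, Multiset.le_iff_count]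
  intro a
  rw [count_roots, count_roots, le_rootMultiplicity_iff hq0]
  have hdvd := pow_rootMultiplicity_dvd R a
  by_cases hRa : R.eval a = 0
  · by_cases ha : ‖a‖ = 1
    · exact h.X_sub_C_pow_dvd ha (hdvd.trans hRp)
    · have hcop : IsCoprime (X - C a) R' :=
        (irreducible_X_sub_C a).coprime_iff_not_dvd.2 fun hdvd' =>
          hR' a ha hRa (dvd_iff_isRoot.1 hdvd')
      exact hcop.pow_left.dvd_of_dvd_mul_right (hmul ▸ hdvd.mul_right u)
  · simp [rootMultiplicity_eq_zero hRa]

lemma natDegree_le_of_natDegree_mul_le {n d : ℕ} {R S : ℂ[X]}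
    (hR : R.eval 0 = 0 → (pstar n R).eval 0 ≠ 0) (hS : (S * R).natDegree ≤ d + n)
    (hS' : (S * pstar n R).natDegree ≤ d + n) : S.natDegree ≤ d := by
  by_contra! hlt
  have hcoeff {T : ℂ[X]} (hT : (S * T).natDegree ≤ d + n) : T.coeff n = 0 := by
    rcases eq_or_ne T 0 with rfl | hT0
    · exact coeff_zero n
    rw [natDegree_mul (ne_zero_of_natDegree_gt hlt) hT0] at hT
    exact coeff_eq_zero_of_natDegree_lt (by omega)
  refine hR ?_ ?_
  · rw [← pstar_pstar n R, eval_zero_pstar, hcoeff hS', map_zero]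
  · rw [eval_zero_pstar, hcoeff hS, map_zero]

lemma mem_selfReciprocal_of_mul_pstar_eq {n d : ℕ} {R S : ℂ[X]} (hR0 : R ≠ 0)
    (hRn : R.natDegree ≤ n) (hSd : S.natDegree ≤ d)
    (h : S * pstar n R = pstar (d + n) (S * R)) : S ∈ selfReciprocal d := by
  rw [pstar_mul hSd hRn] at h
  exact ⟨hSd, (mul_right_cancel₀ (pstar_ne_zero n hR0) h).symm⟩

variable {N : ℕ} {p q : ℂ[X]}

theorem HasBoundedRealRatio.exists_mem_selfReciprocal (h : HasBoundedRealRatio p q) (hp0 : p ≠ 0)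
    (hp : p.natDegree ≤ N) (hq : q.natDegree ≤ N) :
    ∃ S ∈ selfReciprocal (2 * totalMult N p), S * factorR N p = q := by
  have hR0 := factorR_ne_zero hp0 hp
  have hdeg := natDegree_factorR_add_le hp0 hp
  have hGR := factorG_mul_factorR hp
  have hno_common_zero {a : ℂ} := eval_factorRStar_ne_zero (a := a) hp0 hp
  have hqR : q * factorRStar N p = factorR N p * pstar N q := by
    refine mul_left_cancel₀ (factorG_ne_zero (N := N) (p := p)) ?_
    rw [mul_left_comm, factorG_mul_factorRStar hp0 hp, h.mul_pstar_eq hp hq, ← mul_assoc, hGR]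
  obtain ⟨S, rfl⟩ := h.dvd_of_mul_eq hR0 (Dvd.intro_left _ hGR) hqR fun _ => hno_common_zero
  rw [mul_comm _ S] at hq hqR ⊢
  have hSR : S * factorRStar N p = pstar N (S * factorR N p) :=
    mul_left_cancel₀ hR0 (by rw [← hqR]; ring)
  have hN : N = 2 * totalMult N p + (N - 2 * totalMult N p) := by omega
  refine ⟨S, mem_selfReciprocal_of_mul_pstar_eq hR0 (Nat.le_sub_of_add_le hdeg) ?_ (hN ▸ hSR), rfl⟩
  exact natDegree_le_of_natDegree_mul_le (hno_common_zero (by simp)) (hN ▸ hq)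
    (hN ▸ hSR ▸ natDegree_pstar_le hq)

theorem hasBoundedRealRatio_iff (hp0 : p ≠ 0) (hp : p.natDegree ≤ N) (hq : q.natDegree ≤ N) :
    HasBoundedRealRatio p q ↔
      ∃ S ∈ selfReciprocal (2 * totalMult N p), S * factorR N p = q := by
  refine ⟨fun h => h.exists_mem_selfReciprocal hp0 hp hq, ?_⟩
  rintro ⟨S, hS, rfl⟩
  simpa only [factorG_mul_factorR hp] using (hasBoundedRealRatio_of_mem_selfReciprocal hS
    factorG_mem_selfReciprocal fun _ => eval_factorG_ne_zero).mul_right (factorR N p)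

end Multipliers

section Coordinates

/-- The standard real basis of the self-reciprocal polynomials of degree at most `2 * m`. Its
order is that of the columns of `blockMatrix`; `Sum.inr i` carries the frequencies
`m ± (i + 1)`. -/
noncomputable def selfReciprocalBasis (m : ℕ) : Fin (m + 1) ⊕ Fin m → ℂ[X] :=
  Sum.elim (fun l => X ^ (m + l : ℕ) + X ^ (m - l : ℕ))
    fun i => C Complex.I * X ^ (m + (i + 1) : ℕ) - C Complex.I * X ^ (m - (i + 1) : ℕ)

/-- The self-reciprocal polynomial with real coordinates `v` in `selfReciprocalBasis m`. -/
noncomputable def ofCoords (m : ℕ) : (Fin (m + 1) ⊕ Fin m → ℝ) →ₗ[ℝ] ℂ[X] :=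
  Fintype.linearCombination ℝ (selfReciprocalBasis m)

lemma selfReciprocalBasis_mem (m : ℕ) (c : Fin (m + 1) ⊕ Fin m) :
    selfReciprocalBasis m c ∈ selfReciprocal (2 * m) := by
  rcases c with l | i
  · have hdeg : (C (1 : ℂ) * X ^ (m + l : ℕ)).natDegree ≤ 2 * m :=
      (natDegree_C_mul_X_pow_le _ _).trans (by omega)
    convert add_pstar_mem_selfReciprocal hdeg using 1
    rw [pstar_C_mul_X_pow _ (by omega), show 2 * m - (m + l) = m - l by omega]
    simp [selfReciprocalBasis]
  · have hdeg : (C Complex.I * X ^ (m + (i + 1) : ℕ)).natDegree ≤ 2 * m :=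
      (natDegree_C_mul_X_pow_le _ _).trans (by omega)
    convert add_pstar_mem_selfReciprocal hdeg using 1
    rw [pstar_C_mul_X_pow _ (by omega), show 2 * m - (m + (i + 1)) = m - (i + 1) by omega]
    simp [selfReciprocalBasis, sub_eq_add_neg]

lemma ofCoords_mem (m : ℕ) (v : Fin (m + 1) ⊕ Fin m → ℝ) :
    ofCoords m v ∈ selfReciprocal (2 * m) := by
  rw [ofCoords, Fintype.linearCombination_apply]
  exact Submodule.sum_mem _ fun c _ => Submodule.smul_mem _ _ (selfReciprocalBasis_mem m c)

lemma coeff_ofCoords (m n : ℕ) (v : Fin (m + 1) ⊕ Fin m → ℝ) :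
    (ofCoords m v).coeff n = ∑ c, (v c : ℂ) * (selfReciprocalBasis m c).coeff n := by
  simp only [ofCoords, Fintype.linearCombination_apply, finsetSum_coeff, coeff_smul,
    Complex.real_smul]

lemma coeff_ofCoords_mid (m : ℕ) (v : Fin (m + 1) ⊕ Fin m → ℝ) :
    (ofCoords m v).coeff m = 2 * (v (.inl 0) : ℂ) := by
  rw [coeff_ofCoords, Finset.sum_eq_single (.inl 0)]
  · simp only [selfReciprocalBasis, Sum.elim_inl, coeff_add, coeff_X_pow]
    simp [mul_comm, one_add_one_eq_two]
  · rintro (l | i) - hne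
    · have hl : (l : ℕ) ≠ 0 := fun h => hne (congrArg Sum.inl (Fin.ext h))
      simp only [selfReciprocalBasis, Sum.elim_inl, coeff_add, coeff_X_pow]
      rw [if_neg (by omega), if_neg (by omega), add_zero, mul_zero]
    · simp only [selfReciprocalBasis, Sum.elim_inr, coeff_sub, coeff_C_mul, coeff_X_pow]
      rw [if_neg (by omega), if_neg (by omega), sub_self, mul_zero]
  · simp

lemma coeff_ofCoords_add (m : ℕ) (v : Fin (m + 1) ⊕ Fin m → ℝ) (i : Fin m) :
    (ofCoords m v).coeff (m + (i + 1)) = (v (.inl i.succ) : ℂ) + (v (.inr i) : ℂ) * Complex.I := by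
  rw [coeff_ofCoords, Fintype.sum_sum_type, Finset.sum_eq_single i.succ, Finset.sum_eq_single i]
  · simp only [selfReciprocalBasis, Sum.elim_inl, Sum.elim_inr, coeff_add, coeff_sub, coeff_C_mul,
      coeff_X_pow, Fin.val_succ, if_true]
    rw [if_neg (by omega)]
    ring
  · intro j _ hj
    simp only [selfReciprocalBasis, Sum.elim_inr, coeff_sub, coeff_C_mul, coeff_X_pow]
    rw [if_neg (by omega), if_neg (by omega), sub_self, mul_zero]
  · simp
  · intro l _ hl
    have hne : (l : ℕ) ≠ i + 1 := fun h => hl (Fin.ext h)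
    simp only [selfReciprocalBasis, Sum.elim_inl, coeff_add, coeff_X_pow]
    rw [if_neg (by omega), if_neg (by omega), add_zero, mul_zero]
  · simp

lemma ofCoords_injective (m : ℕ) : Function.Injective (ofCoords m) := by
  refine (injective_iff_map_eq_zero _).2 fun v hv => ?_
  have hmid := coeff_ofCoords_mid m v
  have hadd := coeff_ofCoords_add m v
  simp only [hv, coeff_zero] at hmid hadd
  funext c
  rcases c with l | i
  · induction l using Fin.cases with
    | zero => simpa using hmid.symm
    | succ i => simpa using (congrArg Complex.re (hadd i)).symm
  · simpa using (congrArg Complex.im (hadd i)).symm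

lemma selfReciprocal_ext {m : ℕ} {S T : ℂ[X]} (hS : S ∈ selfReciprocal (2 * m))
    (hT : T ∈ selfReciprocal (2 * m)) (hmid : S.coeff m = T.coeff m)
    (hadd : ∀ i : Fin m, S.coeff (m + (i + 1)) = T.coeff (m + (i + 1))) : S = T := by
  have hupper : ∀ n, m ≤ n → n ≤ 2 * m → S.coeff n = T.coeff n := by
    intro n hmn hn
    rcases hmn.eq_or_lt with rfl | hmn
    · exact hmid
    · simpa only [show m + (n - m - 1 + 1) = n by omega] using hadd ⟨n - m - 1, by omega⟩
  refine (ext_iff_natDegree_le hS.1 hT.1).2 fun n hn => ?_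
  rcases le_total m n with hmn | hmn
  · exact hupper n hmn hn
  · rw [coeff_eq_conj_coeff_of_mem_selfReciprocal hS hn,
      coeff_eq_conj_coeff_of_mem_selfReciprocal hT hn, hupper _ (by omega) (by omega)]

theorem range_ofCoords (m : ℕ) : LinearMap.range (ofCoords m) = selfReciprocal (2 * m) := by
  refine le_antisymm (LinearMap.range_le_iff_comap.2 (eq_top_iff.2 fun v _ => ofCoords_mem m v))
    fun S hS => ⟨Sum.elim (Fin.cases ((S.coeff m).re / 2) fun i => (S.coeff (m + (i + 1))).re)
      fun i => (S.coeff (m + (i + 1))).im, ?_⟩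
  refine selfReciprocal_ext (ofCoords_mem m _) hS ?_ fun i => ?_
  · have hreal : ((S.coeff m).re : ℂ) = S.coeff m := Complex.conj_eq_iff_re.1 (by
      simpa [two_mul] using (coeff_eq_conj_coeff_of_mem_selfReciprocal hS (i := m) (by omega)).symm)
    rw [coeff_ofCoords_mid, Sum.elim_inl, Fin.cases_zero, Complex.ofReal_div, hreal]
    exact mul_div_cancel₀ _ two_ne_zero
  · rw [coeff_ofCoords_add, Sum.elim_inl, Fin.cases_succ, Sum.elim_inr, Complex.re_add_im]

end Coordinates

section BlockMatrix

lemma coeff_X_pow_mul_eq_intCoeff (R : ℂ[X]) (a n : ℕ) :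
    (X ^ a * R).coeff n = intCoeff R ((n : ℤ) - a) := by
  rw [coeff_X_pow_mul', intCoeff]
  by_cases h : a ≤ n
  · rw [if_pos h, if_pos (by omega)]
    congr 1
    omega
  · rw [if_neg h, if_neg (by omega)]

lemma coeff_selfReciprocalBasis_inl_mul (R : ℂ[X]) (m n : ℕ) (l : Fin (m + 1)) :
    (selfReciprocalBasis m (.inl l) * R).coeff n =
      intCoeff R ((n : ℤ) + (l : ℕ) - m) + intCoeff R ((n : ℤ) - (l : ℕ) - m) := by
  rw [selfReciprocalBasis, Sum.elim_inl, add_mul, coeff_add, coeff_X_pow_mul_eq_intCoeff,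
    coeff_X_pow_mul_eq_intCoeff, add_comm]
  congr 2 <;> omega

lemma coeff_selfReciprocalBasis_inr_mul (R : ℂ[X]) (m n : ℕ) (i : Fin m) :
    (selfReciprocalBasis m (.inr i) * R).coeff n =
      Complex.I * (intCoeff R ((n : ℤ) - ((i : ℕ) + 1) - m) -
        intCoeff R ((n : ℤ) + ((i : ℕ) + 1) - m)) := by
  rw [selfReciprocalBasis, Sum.elim_inr, ← mul_sub, mul_assoc, coeff_C_mul, sub_mul, coeff_sub,
    coeff_X_pow_mul_eq_intCoeff, coeff_X_pow_mul_eq_intCoeff]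
  congr 3 <;> omega

variable {N M : ℕ} {k : Fin M → ℕ} {p : ℂ[X]}

lemma blockMatrix_inl (j : Fin M) (c : Fin (totalMult N p + 1) ⊕ Fin (totalMult N p)) :
    blockMatrix N k p (.inl j) c =
      ((selfReciprocalBasis (totalMult N p) c * factorR N p).coeff (k j)).re := by
  rcases c with l | i
  · simp [blockMatrix, matAPlus, coeff_selfReciprocalBasis_inl_mul]
  · simp [blockMatrix, matBMinus, coeff_selfReciprocalBasis_inr_mul]

lemma blockMatrix_inr (j : Fin M) (c : Fin (totalMult N p + 1) ⊕ Fin (totalMult N p)) :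
    blockMatrix N k p (.inr j) c =
      ((selfReciprocalBasis (totalMult N p) c * factorR N p).coeff (k j)).im := by
  rcases c with l | i
  · simp [blockMatrix, matBPlus, coeff_selfReciprocalBasis_inl_mul]
  · simp [blockMatrix, matAMinus, coeff_selfReciprocalBasis_inr_mul]

lemma blockMatrix_mulVec_eq_zero_iff_coeff (v : Fin (totalMult N p + 1) ⊕ Fin (totalMult N p) → ℝ) :
    (blockMatrix N k p).mulVec v = 0 ↔
      ∀ j, (ofCoords (totalMult N p) v * factorR N p).coeff (k j) = 0 := by
  have hcoeff (j : Fin M) : (ofCoords (totalMult N p) v * factorR N p).coeff (k j) =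
      ∑ c, v c • (selfReciprocalBasis (totalMult N p) c * factorR N p).coeff (k j) := by
    simp only [ofCoords, Fintype.linearCombination_apply, Finset.sum_mul, smul_mul_assoc,
      finsetSum_coeff, coeff_smul]
  simp only [funext_iff, Sum.forall, Matrix.mulVec, dotProduct, blockMatrix_inl, blockMatrix_inr,
    Pi.zero_apply, ← forall_and, Complex.ext_iff, hcoeff, Complex.re_sum, Complex.im_sum,
    Complex.smul_re, Complex.smul_im, smul_eq_mul, mul_comm (v _), Complex.zero_re,
    Complex.zero_im]

lemma natDegree_le_of_mem_polySpace_freqSet {f : ℂ[X]}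
    (hf : f ∈ polySpace (freqSet N k)) : f.natDegree ≤ N :=
  natDegree_le_iff_coeff_eq_zero.2 fun i hi => hf i (by
    simp only [freqSet, Finset.mem_sdiff, Finset.mem_range]
    omega)

lemma mem_polySpace_freqSet_iff {f : ℂ[X]} (hf : f.natDegree ≤ N) :
    f ∈ polySpace (freqSet N k) ↔ ∀ j, f.coeff (k j) = 0 := by
  refine ⟨fun h j => h _ (by simp [freqSet]), fun h i hi => ?_⟩
  rcases le_or_gt i N with hiN | hiN
  · obtain ⟨j, rfl⟩ : ∃ j, k j = i := by
      simpa [freqSet, Nat.lt_succ_of_le hiN] using hi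
    exact h j
  · exact coeff_eq_zero_of_natDegree_lt (hf.trans_lt hiN)

theorem blockMatrix_mulVec_eq_zero_iff (hp0 : p ≠ 0) (hp : p.natDegree ≤ N)
    (v : Fin (totalMult N p + 1) ⊕ Fin (totalMult N p) → ℝ) :
    (blockMatrix N k p).mulVec v = 0 ↔
      ofCoords (totalMult N p) v * factorR N p ∈ polySpace (freqSet N k) := by
  rw [blockMatrix_mulVec_eq_zero_iff_coeff, mem_polySpace_freqSet_iff]
  have hS := (ofCoords_mem (totalMult N p) v).1
  have hR := natDegree_factorR_add_le hp0 hp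
  exact natDegree_mul_le.trans (by omega)

end BlockMatrix

section Extremality

theorem mem_extremePoints_ball_iff_mul_factorR {N : ℕ} {Λ : Finset ℕ} {p : ℂ[X]}
    (hΛ : ∀ q ∈ polySpace Λ, q.natDegree ≤ N) (hp : p ∈ polySpace Λ) (hnorm : l1Norm p = 1) :
    p ∈ Set.extremePoints ℝ (ball Λ) ↔ ∀ S ∈ selfReciprocal (2 * totalMult N p),
      S * factorR N p ∈ polySpace Λ → S ∈ Submodule.span ℝ {factorG N p} := by
  have hp0 := ne_zero_of_l1Norm_eq_one hnorm
  have hspan (S : ℂ[X]) : S * factorR N p ∈ Submodule.span ℝ {p} ↔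
      S ∈ Submodule.span ℝ {factorG N p} := by
    simp only [Submodule.mem_span_singleton]
    refine exists_congr fun c => ?_
    nth_rw 1 [← factorG_mul_factorR (hΛ p hp)]
    rw [← smul_mul_assoc, mul_left_inj' (factorR_ne_zero hp0 (hΛ p hp))]
  rw [mem_extremePoints_ball_iff hp hnorm]
  constructor
  · intro h S hS hSR
    exact (hspan S).1 (h _ hSR
      ((hasBoundedRealRatio_iff hp0 (hΛ p hp) (hΛ _ hSR)).2 ⟨S, hS, rfl⟩))
  · intro h q hq hpq
    obtain ⟨S, hS, rfl⟩ := (hasBoundedRealRatio_iff hp0 (hΛ p hp) (hΛ q hq)).1 hpq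
    exact (hspan S).2 (h S hS hq)

end Extremality

end Lacunary

open Lacunary in
theorem theorem2p1_general {N M : ℕ} {k : Fin M → ℕ} {p : ℂ[X]} (hp : p ∈ polySpace (freqSet N k))
    (hnorm : l1Norm p = 1) :
    p ∈ Set.extremePoints ℝ (ball (freqSet N k)) ↔
      (blockMatrix N k p).rank = 2 * totalMult N p := by
  have hp0 := ne_zero_of_l1Norm_eq_one hnorm
  have hdeg := natDegree_le_of_mem_polySpace_freqSet hp
  have hrange := range_ofCoords (totalMult N p)
  obtain ⟨w, hw⟩ : factorG N p ∈ LinearMap.range (ofCoords (totalMult N p)) :=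
    hrange ▸ factorG_mem_selfReciprocal
  have hw0 : w ≠ 0 := fun h => factorG_ne_zero (by rw [← hw, h, map_zero])
  have hwker : (blockMatrix N k p).mulVec w = 0 := by
    rwa [blockMatrix_mulVec_eq_zero_iff hp0 hdeg, hw, factorG_mul_factorR hdeg]
  have hspan (v) : ofCoords (totalMult N p) v ∈ Submodule.span ℝ {factorG N p} ↔
      v ∈ Submodule.span ℝ {w} := by
    simp only [← hw, Submodule.mem_span_singleton, ← map_smul, (ofCoords_injective _).eq_iff]
  rw [mem_extremePoints_ball_iff_mul_factorR
      (fun _ => natDegree_le_of_mem_polySpace_freqSet) hp hnorm,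
    rank_eq_iff_forall_mulVec_eq_zero (by simp; ring) hw0 hwker, ← hrange]
  simp only [LinearMap.mem_range, forall_exists_index, forall_apply_eq_imp_iff, hspan,
    blockMatrix_mulVec_eq_zero_iff hp0 hdeg]

theorem theorem2p1 (N M : ℕ) (hN : 0 < N) (k : Fin M → ℕ) (hk : StrictMono k)
    (hk_pos : ∀ j, 0 < k j) (hk_lt : ∀ j, k j < N)
    (p : Polynomial ℂ) (hp : p ∈ Lacunary.polySpace (Lacunary.freqSet N k))
    (hnorm : Lacunary.l1Norm p = 1) :
    p ∈ Set.extremePoints ℝ (Lacunary.ball (Lacunary.freqSet N k)) ↔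
      (Lacunary.blockMatrix N k p).rank = 2 * Lacunary.totalMult N p :=
  theorem2p1_general hp hnorm
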